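/- For $n\ge 1$, $s\in\mathbb R$ and $t>0$ let $\mathcal G_s^{n\times n}([0,t])$ be the set of real $n\times n$ upper Hessenberg matrices whose subdiagonal entries all equal $s$ and whose upper triangular entries (diagonal included) lie in $[0,t]$, and let $M_n=M_n(s,t)=\max\{|\det A| : A\in\mathcal G_s^{n\times n}([0,t])\}$. A matrix attaining this maximum is called maximizing. Let $U_n=(a_{ij})$ be the $n\times n$ matrix with $a_{i+1,i}=s$, $a_{ij}=t$ if $j\ge i$ and $j-i$ is even, and $a_{ij}=0$ otherwise. For $n\ge4$ let $U_n^{(rc)}$ be obtained from $U_n$ by replacing the first two entries $t,s$ of the first column by $s,t$ and the last two entries $s,t$ of the last row by $t,s$, and then interchanging the first two rows and the last two columns. Theorem 2.8 (with the maximizing matrices). Let $n\ge4$. There is $\epsilon(n)>0$, depending only on $n$, such that for all real $s,t$ with $t>0$ and $t\le s\le t(1+\epsilon(n))$: 1. $M_4=3s^2t^2$; $M_5=s^4t+4s^2t^3$ if $n\ge5$; and $M_m=tM_{m-1}+s^2M_{m-2}$ for all $5<m\le n$; 2. the maximum $M_n$ is attained by $U_n^{(rc)}$, and if $s>t$, then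 $U_n^{(rc)}$ is the only maximizing matrix. Moreover, the maximizing matrix switches from $U_n$ to $U_n^{(rc)}$ at $s/t=1$: for all $s,t>0$, the matrix $U_n$ is maximizing if and only if $s\le t$, and $U_n^{(rc)}$ is not maximizing if $s<t$. -/

import Mathlib

/-- The set of `n × n` upper Hessenberg real matrices whose subdiagonal entries are all equal to `s`
and whose upper triangular entries (diagonal included) lie in `P`. -/
def hessenberg (n : ℕ) (s : ℝ) (P : Set ℝ) : Set (Matrix (Fin n) (Fin n) ℝ) :=
  {A | ∀ i j : Fin n,
    ((i : ℕ) ≤ j → A i j ∈ P) ∧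
    ((i : ℕ) = j + 1 → A i j = s) ∧
    ((j : ℕ) + 1 < i → A i j = 0)}

/-- The maximum absolute determinant over the Hessenberg matrices with subdiagonal `s` and upper
triangular entries in `[0, t]` (the supremum of a compact set of reals, non-empty for `0 ≤ t`). -/
noncomputable def maxAbsDet (n : ℕ) (s t : ℝ) : ℝ :=
  sSup ((fun A : Matrix (Fin n) (Fin n) ℝ => |A.det|) '' hessenberg n s (Set.Icc 0 t))

/-- `A` is a maximizing matrix: it belongs to the class and has the largest absolute determinant. -/
def IsMaximizing (n : ℕ) (s t : ℝ) (A : Matrix (Fin n) (Fin n) ℝ) : Prop :=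
  A ∈ hessenberg n s (Set.Icc 0 t) ∧
    ∀ B ∈ hessenberg n s (Set.Icc 0 t), |B.det| ≤ |A.det|

/-- Entry of `U` in (zero-based) row `i` and column `j`: `s` on the subdiagonal, `t` where `j ≥ i`
and `j - i` is even, and `0` elsewhere. -/
noncomputable def uEntry (s t : ℝ) (i j : ℕ) : ℝ :=
  if i = j + 1 then s else if i ≤ j ∧ Even (j - i) then t else 0

/-- The matrix `U_n(s,t)`. -/
noncomputable def matU (n : ℕ) (s t : ℝ) : Matrix (Fin n) (Fin n) ℝ :=
  Matrix.of fun i j => uEntry s t i j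

/-- Entries of the matrix that agrees with `U_n` except that the first two entries `t, s` of the
first column become `s, t` and the last two entries `s, t` of the last row become `t, s`. -/
noncomputable def urcSwappedEntry (n : ℕ) (s t : ℝ) (i j : ℕ) : ℝ :=
  if (i = 0 ∧ j = 0) ∨ (i + 1 = n ∧ j + 1 = n) then s
  else if (i = 1 ∧ j = 0) ∨ (i + 1 = n ∧ j + 2 = n) then t
  else uEntry s t i j

/-- The matrix `U_n^{(rc)}(s,t)` (meant for `n ≥ 4`): interchange the first two rows and the last two
columns of the matrix with entries `urcSwappedEntry`. -/
noncomputable def matUrc (n : ℕ) (s t : ℝ) : Matrix (Fin n) (Fin n) ℝ :=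
  Matrix.of fun i j =>
    urcSwappedEntry n s t (Equiv.swap 0 1 (i : ℕ)) (Equiv.swap (n - 2) (n - 1) (j : ℕ))

/-! Put `p = t / s`. The normalized leading minors satisfy `d 0 = 1` and `s * d (c + 1) = -∑ a k c *
d k`. For prescribed signs of the minors, column `c` does best with `t` against the `d k` of sign
opposite to `d (c + 1)` and `0` elsewhere. Recording the sums of the positive and of the negative
minors leaves a finite problem over sign words: each letter adds `p` times one sum to the other.
`exists_word_bound` bounds every determinant by the value of a word, with rigidity under equality.

For `p ≥ 1` alternation is optimal and yields Fibonacci polynomials (`wordState_le_fibPoly`). At `p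
= 1` four words of length `n + 1` tie, since the letters `w 2` and `w (n - 1)` become free
(`word_of_wordState_add_eq`). For `p < 1` the tie breaks in favour of delaying both sign changes,
which is `rcWord`; its gain over alternation carries the factor `1 - p ^ 2` (`rcValue_sub`). Every
other word is strictly worse at `p = 1`, hence also near `1` by continuity, and finitely many words
and orders give a common `ε`. -/

open Filter Topology

/-! ### Determinants through normalized minors -/

/-- The leading principal minors of order `j` of a Hessenberg matrix, divided by `(-s) ^ j`. -/
noncomputable def minorSeq (s : ℝ) (a : ℕ → ℕ → ℝ) : ℕ → ℝ
  | 0 => 1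
  | c + 1 => -(1 / s) * ∑ k : Fin (c + 1), a k c * minorSeq s a k

lemma minorSeq_zero (s : ℝ) (a : ℕ → ℕ → ℝ) : minorSeq s a 0 = 1 := by
  rw [minorSeq]

lemma minorSeq_succ (s : ℝ) (a : ℕ → ℕ → ℝ) (c : ℕ) :
    minorSeq s a (c + 1) = -(1 / s) * ∑ k ∈ Finset.range (c + 1), a k c * minorSeq s a k := by
  rw [minorSeq, Finset.sum_range]

/-- The determinant of a Hessenberg matrix through its normalized leading minors. -/
lemma det_eq_minorSeq {s : ℝ} (hs : s ≠ 0) (a : ℕ → ℕ → ℝ) (m : ℕ)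
    (hsub : ∀ j, j < m → a (j + 1) j = s)
    (hlow : ∀ i j, i ≤ m → j + 1 < i → a i j = 0) :
    (Matrix.of fun i j : Fin (m + 1) => a i j).det = (-s) ^ (m + 1) * minorSeq s a (m + 1) := by
  set A : Matrix (Fin (m + 1)) (Fin (m + 1)) ℝ := Matrix.of fun i j => a i j with hA
  set d := minorSeq s a with hd
  -- Row 0 has coefficient `d 0 = 1`, so this row operation preserves the determinant.
  have h1 : (A.updateRow 0 (∑ k : Fin (m + 1), d k • A k)).det = A.det := by
    have := Matrix.det_updateRow_sum A 0 (fun k : Fin (m + 1) => d k)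
    rw [this]
    simp [hd, minorSeq_zero]
  have hrow : ∀ j : Fin (m + 1), (∑ k : Fin (m + 1), d k • A k) j
      = if j = Fin.last m then -s * d (m + 1) else 0 := by
    intro j
    have e : (∑ k : Fin (m + 1), d k • A k) j = ∑ k ∈ Finset.range (m + 1), a k j * d k := by
      rw [Finset.sum_apply, Finset.sum_range]
      exact Finset.sum_congr rfl fun k _ => by simp [hA, mul_comm]
    rw [e]
    split_ifs with hj
    · subst hj
      rw [hd, minorSeq_succ]
      simp only [Fin.val_last]
      field_simp
    · have hjm : (j : ℕ) < m := Fin.val_lt_last hj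
      -- Column `j` stops at row `j + 1`. Its upper part contributes `-s * d (j + 1)` by the
      -- recursion, and the subdiagonal entry cancels this.
      have hsplit : Finset.range (j + 2) ⊆ Finset.range (m + 1) := by
        intro x; simp only [Finset.mem_range]; omega
      rw [← Finset.sum_subset hsplit, Finset.sum_range_succ, hsub _ hjm, hd, minorSeq_succ]
      · field_simp
        ring
      · intro x hx hx'
        simp only [Finset.mem_range] at hx hx'
        rw [hlow x j (by omega) (by omega), zero_mul]
  rw [← h1, Matrix.det_succ_row_zero]
  rw [Finset.sum_eq_single (Fin.last m)]
  · have hminor : ((A.updateRow 0 (∑ k : Fin (m + 1), d k • A k)).submatrix Fin.succ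
        (Fin.last m).succAbove).det = s ^ m := by
      rw [Matrix.det_of_isUpperTriangular]
      · rw [Finset.prod_congr rfl (g := fun _ => s)]
        · simp
        · intro i _
          simp [hA, Matrix.updateRow_ne, hsub i i.2]
      · intro i j hij
        simp only [id] at hij
        simp only [Matrix.submatrix_apply, Fin.succAbove_last]
        rw [Matrix.updateRow_ne (Fin.succ_ne_zero i)]
        simp only [hA, Matrix.of_apply, Fin.val_succ, Fin.val_castSucc]
        exact hlow _ _ (by omega) (by have : (j : ℕ) < i := hij; omega)
    rw [hminor, Matrix.updateRow_self, hrow]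
    simp only [Fin.val_last, if_true]
    rw [neg_pow s (m + 1)]
    ring
  · intro j _ hj
    rw [Matrix.updateRow_self, hrow, if_neg hj]
    simp
  · simp

/-! ### Sign words and their extremal matrices -/

/-- Sums of the positive and of the negative terms of a sequence with sign word `w`: each step adds
`p` times one of them to the other. -/
def wordState (p : ℝ) (w : ℕ → Bool) : ℕ → Bool → ℝ
  | 0 => fun b => if b then 1 else 0
  | j + 1 => fun b => wordState p w j b + if b = w (j + 1) then p * wordState p w j (!b) else 0

/-- The sign of a boolean. -/
def boolSign (b : Bool) : ℝ := if b then 1 else -1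

lemma boolSign_of_ne {b c : Bool} (h : b ≠ c) : boolSign b = -boolSign c := by
  cases b <;> cases c <;> simp [boolSign] at *

lemma abs_boolSign_mul (b : Bool) (x : ℝ) : |boolSign b * x| = |x| := by
  cases b <;> simp [boolSign]

/-- The partial sums, up to sign, of the terms of `d` with sign `b`. -/
def signedSum (w : ℕ → Bool) (d : ℕ → ℝ) (j : ℕ) (b : Bool) : ℝ :=
  ∑ k ∈ Finset.range (j + 1), if w k = b then boolSign (w k) * d k else 0

lemma wordState_succ (p : ℝ) (w : ℕ → Bool) (j : ℕ) (b : Bool) :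
    wordState p w (j + 1) b =
      wordState p w j b + if b = w (j + 1) then p * wordState p w j (!b) else 0 := rfl

lemma signedSum_succ (w : ℕ → Bool) (d : ℕ → ℝ) (j : ℕ) (b : Bool) :
    signedSum w d (j + 1) b =
      signedSum w d j b + if b = w (j + 1) then boolSign (w (j + 1)) * d (j + 1) else 0 := by
  rw [signedSum, Finset.sum_range_succ]
  simp only [signedSum, eq_comm]

lemma signedSum_zero {w : ℕ → Bool} (hw : w 0 = true) {d : ℕ → ℝ} (hd : d 0 = 1) (p : ℝ)
    (b : Bool) : signedSum w d 0 b = wordState p w 0 b := by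
  cases b <;> simp [signedSum, wordState, hw, hd, boolSign]

lemma wordState_nonneg {p : ℝ} (hp : 0 ≤ p) (w : ℕ → Bool) (j : ℕ) :
    ∀ b, 0 ≤ wordState p w j b := by
  induction j with
  | zero => intro b; cases b <;> simp [wordState]
  | succ j ih =>
    intro b
    have h1 := ih b
    have h2 := ih (!b)
    simp only [wordState]
    split_ifs <;> positivity

/-- The first letter `false` makes both sums positive at once. This later keeps the minors nonzero
in the equality case. -/
lemma wordState_pos {p : ℝ} (hp : 0 < p) {w : ℕ → Bool} (h1 : w 1 = false) (j : ℕ) :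
    ∀ b, 0 < wordState p w (j + 1) b := by
  induction j with
  | zero => intro b; cases b <;> simp [wordState, h1, hp]
  | succ j ih =>
    intro b
    have h1 := ih b
    have h2 := ih (!b)
    rw [wordState_succ]
    split_ifs <;> positivity

/-- Entry of the extremal matrix with sign word `w`. -/
noncomputable def wordEntry (s t : ℝ) (w : ℕ → Bool) (i j : ℕ) : ℝ :=
  if i = j + 1 then s else if i ≤ j ∧ w i ≠ w (j + 1) then t else 0

lemma wordEntry_mem {s t : ℝ} (ht : 0 ≤ t) (w : ℕ → Bool) (n : ℕ) :
    (Matrix.of fun i j : Fin n => wordEntry s t w i j) ∈ hessenberg n s (Set.Icc 0 t) := by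
  intro i j
  simp only [Matrix.of_apply, wordEntry]
  refine ⟨fun h => ?_, fun h => by rw [if_pos h], fun h => ?_⟩
  · rw [if_neg (by omega)]
    split_ifs
    · exact ⟨ht, le_rfl⟩
    · exact ⟨le_rfl, ht⟩
  · rw [if_neg (by omega), if_neg (by omega)]

/-- Column `c` selects exactly the minors whose letter differs from `w (c + 1)`. The identity is
purely algebraic: `w` need not be known to give the true signs. -/
lemma minorSeq_wordEntry {s : ℝ} (t : ℝ) (w : ℕ → Bool) (c : ℕ) :
    boolSign (w (c + 1)) * minorSeq s (wordEntry s t w) (c + 1) =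
      t / s * signedSum w (minorSeq s (wordEntry s t w)) c (!w (c + 1)) := by
  rw [minorSeq_succ, signedSum, Finset.mul_sum, Finset.mul_sum, Finset.mul_sum]
  refine Finset.sum_congr rfl fun k hk => ?_
  have hk' : k ≤ c := by simpa [Nat.lt_succ_iff] using hk
  rw [wordEntry, if_neg (by omega)]
  by_cases h : w k = w (c + 1)
  · rw [if_neg (by simp [h]), if_neg (by simp [h])]
    ring
  · rw [if_pos ⟨hk', h⟩, if_pos (by cases h1 : w k <;> cases h2 : w (c + 1) <;> simp_all),
      boolSign_of_ne h]
    ring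

lemma signedSum_wordEntry (s t : ℝ) {w : ℕ → Bool} (hw : w 0 = true) (j : ℕ) :
    ∀ b, signedSum w (minorSeq s (wordEntry s t w)) j b = wordState (t / s) w j b := by
  induction j with
  | zero => exact signedSum_zero hw (minorSeq_zero _ _) _
  | succ j ih =>
    intro b
    rw [signedSum_succ, wordState_succ, ih b, minorSeq_wordEntry, ih]
    split_ifs with h
    · rw [h]
    · rfl

lemma abs_det_wordEntry {s t : ℝ} (hs : 0 < s) (ht : 0 < t) {w : ℕ → Bool} (hw : w 0 = true)
    (m : ℕ) :
    |(Matrix.of fun i j : Fin (m + 1) => wordEntry s t w i j).det| =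
      s ^ m * t * wordState (t / s) w m (!w (m + 1)) := by
  rw [det_eq_minorSeq hs.ne' _ m (fun j _ => by simp [wordEntry])
    (fun i j _ h => by rw [wordEntry, if_neg (by omega), if_neg (by omega)]),
    abs_mul, ← abs_boolSign_mul (w (m + 1)) (minorSeq _ _ _), minorSeq_wordEntry, signedSum_wordEntry s t hw,
    abs_pow, abs_neg, abs_of_pos hs, abs_of_nonneg
      (mul_nonneg (by positivity) (wordState_nonneg (by positivity) _ _ _))]
  field_simp
  ring

/-! ### Upper bound by a sign word, and the equality case -/

/-- Signs of the normalized minors. -/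
noncomputable def signWord (d : ℕ → ℝ) (k : ℕ) : Bool := decide (0 ≤ d k)

lemma boolSign_signWord (d : ℕ → ℝ) (k : ℕ) : boolSign (signWord d k) * d k = |d k| := by
  by_cases h : 0 ≤ d k
  · simp [signWord, boolSign, h, abs_of_nonneg]
  · simp [signWord, boolSign, h, abs_of_neg (not_le.1 h)]

section Bound

variable {s t : ℝ} {a : ℕ → ℕ → ℝ} {m : ℕ}

/-- A minor of sign `b` only hurts, so the best coefficient is `0`; one of the opposite sign helps,
so the best is `t`. -/
lemma term_le {w : ℕ → Bool} {d : ℕ → ℝ} {k : ℕ} (b : Bool) (hd : boolSign (w k) * d k = |d k|)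
    {x : ℝ} (hx : x ∈ Set.Icc 0 t) :
    boolSign b * -(x * d k) ≤ t * if w k = !b then boolSign (w k) * d k else 0 := by
  have hd0 := abs_nonneg (d k)
  by_cases h : w k = b
  · rw [if_neg (by simp [h]), ← h]
    have : boolSign (w k) * -(x * d k) = -(x * |d k|) := by rw [← hd]; ring
    rw [this]
    nlinarith [mul_nonneg hx.1 hd0]
  · rw [if_pos (by cases h1 : w k <;> cases h2 : b <;> simp_all), hd]
    have : boolSign b * -(x * d k) = x * |d k| := by rw [← hd, boolSign_of_ne h]; ring
    rw [this]
    exact mul_le_mul_of_nonneg_right hx.2 hd0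

lemma abs_minorSeq_succ (hs : 0 < s) {w : ℕ → Bool} (c : ℕ)
    (hd : boolSign (w (c + 1)) * minorSeq s a (c + 1) = |minorSeq s a (c + 1)|) :
    s * |minorSeq s a (c + 1)| =
      ∑ k ∈ Finset.range (c + 1), boolSign (w (c + 1)) * -(a k c * minorSeq s a k) := by
  rw [← hd, minorSeq_succ, ← Finset.mul_sum, Finset.sum_neg_distrib]
  field_simp

lemma abs_minorSeq_succ_le (hs : 0 < s) {w : ℕ → Bool}
    (hw : ∀ k, boolSign (w k) * minorSeq s a k = |minorSeq s a k|)
    {c : ℕ} (ha : ∀ i, i ≤ c → a i c ∈ Set.Icc 0 t) :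
    |minorSeq s a (c + 1)| ≤ t / s * signedSum w (minorSeq s a) c (!w (c + 1)) := by
  rw [div_mul_eq_mul_div, le_div_iff₀ hs, mul_comm, abs_minorSeq_succ hs c (hw _), signedSum,
    Finset.mul_sum]
  exact Finset.sum_le_sum fun k hk =>
    term_le _ (hw k) (ha k (by simpa [Nat.lt_succ_iff] using hk))

/-- Equality of the sums forces equality in each `term_le`, and a nonzero minor can then be
cancelled. -/
lemma entry_eq_of_abs_minorSeq_eq (hs : 0 < s) {w : ℕ → Bool}
    (hw : ∀ k, boolSign (w k) * minorSeq s a k = |minorSeq s a k|)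
    {c : ℕ} (ha : ∀ i, i ≤ c → a i c ∈ Set.Icc 0 t) (hne : ∀ i, i ≤ c → minorSeq s a i ≠ 0)
    (h : |minorSeq s a (c + 1)| = t / s * signedSum w (minorSeq s a) c (!w (c + 1))) :
    ∀ i, i ≤ c → a i c = wordEntry s t w i c := by
  intro i hi
  rw [div_mul_eq_mul_div, eq_div_iff hs.ne', mul_comm, abs_minorSeq_succ hs c (hw _), signedSum,
    Finset.mul_sum, Finset.sum_eq_sum_iff_of_le fun k hk =>
    term_le _ (hw k) (ha k (by simpa [Nat.lt_succ_iff] using hk))] at h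
  have h := h i (by simpa [Nat.lt_succ_iff] using hi)
  have hpos : |minorSeq s a i| ≠ 0 := abs_ne_zero.2 (hne i hi)
  rw [wordEntry, if_neg (by omega)]
  by_cases hwi : w i = w (c + 1)
  · rw [if_neg (by simp [hwi])]
    rw [if_neg (by simp [hwi]), ← hwi] at h
    have e : boolSign (w i) * -(a i c * minorSeq s a i) = -(a i c * |minorSeq s a i|) := by
      rw [← hw]; ring
    rw [e, mul_zero, neg_eq_zero] at h
    exact (mul_eq_zero.1 h).resolve_right hpos
  · rw [if_pos ⟨hi, hwi⟩]
    rw [if_pos (by cases h1 : w i <;> cases h2 : w (c + 1) <;> simp_all), hw] at h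
    have e : boolSign (w (c + 1)) * -(a i c * minorSeq s a i) = a i c * |minorSeq s a i| := by
      rw [← hw, boolSign_of_ne hwi]; ring
    rw [e] at h
    exact mul_right_cancel₀ hpos h

/-- Each new minor is at most `p` times an earlier sum, and the word recursion is monotone in both
sums because `p > 0`. -/
lemma signedSum_le_wordState (hs : 0 < s) (ht : 0 < t) {w : ℕ → Bool} (hw0 : w 0 = true)
    (hw : ∀ k, boolSign (w k) * minorSeq s a k = |minorSeq s a k|)
    (ha : ∀ i j, i ≤ j → j ≤ m → a i j ∈ Set.Icc 0 t) (j : ℕ) (hj : j ≤ m + 1) :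
    ∀ b, signedSum w (minorSeq s a) j b ≤ wordState (t / s) w j b := by
  induction j with
  | zero => exact fun b => (signedSum_zero hw0 (minorSeq_zero _ _) _ b).le
  | succ j ih =>
    intro b
    have ih := ih (by omega)
    rw [signedSum_succ, wordState_succ, hw]
    refine add_le_add (ih b) ?_
    split_ifs with h
    · refine (abs_minorSeq_succ_le hs hw fun i hi => ha i j hi (by omega)).trans ?_
      rw [h]
      exact mul_le_mul_of_nonneg_left (ih _) (by positivity)
    · exact le_rfl

/-- If the final sums agree with those of the sign word, so do all the earlier ones. -/
lemma eq_wordState_of_le (hs : 0 < s) (ht : 0 < t) {w : ℕ → Bool} (hw0 : w 0 = true)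
    (hw : ∀ k, boolSign (w k) * minorSeq s a k = |minorSeq s a k|)
    (ha : ∀ i j, i ≤ j → j ≤ m → a i j ∈ Set.Icc 0 t) (j : ℕ) (hj : j ≤ m + 1)
    (h : ∀ b, wordState (t / s) w j b ≤ signedSum w (minorSeq s a) j b) :
    ∀ c, c < j → |minorSeq s a (c + 1)| = t / s * signedSum w (minorSeq s a) c (!w (c + 1)) ∧
      ∀ b, signedSum w (minorSeq s a) c b = wordState (t / s) w c b := by
  induction j with
  | zero => intro c hc; omega
  | succ j ih =>
    have hp : 0 < t / s := div_pos ht hs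
    have hle := signedSum_le_wordState hs ht hw0 hw ha j (by omega)
    have hst := abs_minorSeq_succ_le hs hw fun i hi => ha i j hi (by omega)
    have h1 := h (w (j + 1))
    have h2 := h (!w (j + 1))
    rw [signedSum_succ, wordState_succ, hw, if_pos rfl, if_pos rfl] at h1
    rw [signedSum_succ, wordState_succ, if_neg (by simp), if_neg (by simp), add_zero, add_zero] at h2
    have h3 := hle (w (j + 1))
    have h4 := hle (!w (j + 1))
    have h5 := mul_le_mul_of_nonneg_left h4 hp.le
    have key : ∀ b, wordState (t / s) w j b ≤ signedSum w (minorSeq s a) j b := by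
      intro b
      by_cases hb : b = w (j + 1)
      · rw [hb]; linarith
      · rw [show b = !w (j + 1) by cases b <;> cases h : w (j + 1) <;> simp_all]; exact h2
    intro c hc
    rcases Nat.lt_succ_iff_lt_or_eq.1 hc with hc | rfl
    · exact ih (by omega) key c hc
    · exact ⟨le_antisymm hst (by linarith), fun b => le_antisymm (hle b) (key b)⟩

end Bound

/-- Natural-number indexed data of a member of the class. -/
lemma exists_entries {n : ℕ} {s t : ℝ} {A : Matrix (Fin n) (Fin n) ℝ}
    (hA : A ∈ hessenberg n s (Set.Icc 0 t)) :
    ∃ a : ℕ → ℕ → ℝ, A = Matrix.of (fun i j : Fin n => a i j) ∧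
      (∀ i j, i ≤ j → j < n → a i j ∈ Set.Icc 0 t) ∧ (∀ j, j + 1 < n → a (j + 1) j = s) ∧
      ∀ i j, i < n → j + 1 < i → a i j = 0 := by
  refine ⟨fun i j => if h : i < n ∧ j < n then A ⟨i, h.1⟩ ⟨j, h.2⟩ else 0, ?_, ?_, ?_, ?_⟩
  · ext i j; simp
  · intro i j hij hj
    simp only [dif_pos (show i < n ∧ j < n by omega)]
    exact (hA _ _).1 hij
  · intro j hj
    simp only [dif_pos (show j + 1 < n ∧ j < n by omega)]
    exact (hA _ _).2.1 rfl
  · intro i j hi hj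
    simp only [dif_pos (show i < n ∧ j < n by omega)]
    exact (hA _ _).2.2 hj

/-- Every determinant is bounded by the value of a sign word; under equality the matrix is the
extremal matrix of that word. -/
lemma exists_word_bound {m : ℕ} {s t : ℝ} (hs : 0 < s) (ht : 0 < t)
    {A : Matrix (Fin (m + 1)) (Fin (m + 1)) ℝ} (hA : A ∈ hessenberg (m + 1) s (Set.Icc 0 t)) :
    ∃ w : ℕ → Bool, w 0 = true ∧
      |A.det| ≤ s ^ m * t * wordState (t / s) w m (!w (m + 1)) ∧
      (0 < m → w 1 = false → w (m + 1) = (!w m) →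
        |A.det| = s ^ m * t * wordState (t / s) w m (!w (m + 1)) →
        A = Matrix.of fun i j : Fin (m + 1) => wordEntry s t w i j) := by
  obtain ⟨a, rfl, ha, hsub, hlow⟩ := exists_entries hA
  have ha' : ∀ i j, i ≤ j → j ≤ m → a i j ∈ Set.Icc 0 t := fun i j h1 h2 => ha i j h1 (by omega)
  set w := signWord (minorSeq s a) with hwdef
  have hw : ∀ k, boolSign (w k) * minorSeq s a k = |minorSeq s a k| :=
    boolSign_signWord (minorSeq s a)
  have hw0 : w 0 = true := by simp [hwdef, signWord, minorSeq_zero]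
  have hp : 0 < t / s := div_pos ht hs
  have hdet : |(Matrix.of fun i j : Fin (m + 1) => a i j).det|
      = s ^ (m + 1) * |minorSeq s a (m + 1)| := by
    rw [det_eq_minorSeq hs.ne' a m (fun j hj => hsub j (by omega))
      (fun i j hi => hlow i j (by omega)), abs_mul, abs_pow, abs_neg, abs_of_pos hs]
  have h1 := abs_minorSeq_succ_le hs hw fun i hi => ha' i m hi le_rfl
  have h2 := signedSum_le_wordState hs ht hw0 hw ha' m (by omega) (!w (m + 1))
  have h3 := mul_le_mul_of_nonneg_left h2 hp.le
  have e : ∀ x, s ^ m * t * x = s ^ (m + 1) * (t / s * x) := fun x => by field_simp; ring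
  refine ⟨w, hw0, ?_, fun hm hw1 hlast heq => ?_⟩
  · rw [hdet, e]
    exact mul_le_mul_of_nonneg_left (h1.trans h3) (by positivity)
  · rw [hdet, e] at heq
    have heq := mul_left_cancel₀ (by positivity) heq
    -- As `w (m + 1)` differs from `w m`, equality controls only the sum of sign `w m`. That sum
    -- contains `p` times the other one from the step before, so both turn out extremal.
    have hfin : signedSum w (minorSeq s a) m (w m) = wordState (t / s) w m (w m) := by
      rw [hlast, Bool.not_not] at h1 h2 h3 heq
      exact mul_left_cancel₀ hp.ne' (le_antisymm h3 (heq ▸ h1))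
    obtain ⟨q, rfl⟩ : ∃ q, m = q + 1 := ⟨m - 1, by omega⟩
    have hle := signedSum_le_wordState hs ht hw0 hw ha' q (by omega)
    have hst := abs_minorSeq_succ_le hs hw fun i hi => ha' i q hi (by omega)
    have hq : ∀ b, wordState (t / s) w (q + 1) b ≤ signedSum w (minorSeq s a) (q + 1) b := by
      intro b
      by_cases hb : b = w (q + 1)
      · rw [hb, hfin]
      · have hb' : b = !w (q + 1) := by cases b <;> cases h : w (q + 1) <;> simp_all
        rw [signedSum_succ, wordState_succ, if_neg hb, if_neg hb, add_zero, add_zero, hb']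
        rw [signedSum_succ, wordState_succ, hw, if_pos rfl, if_pos rfl] at hfin
        have h6 := hle (w (q + 1))
        exact le_of_mul_le_mul_left (by linarith) hp
    have hall := eq_wordState_of_le hs ht hw0 hw ha' (q + 1) (by omega) hq
    have hcol : ∀ c, c < q + 2 →
        |minorSeq s a (c + 1)| = t / s * signedSum w (minorSeq s a) c (!w (c + 1)) := by
      intro c hc
      rcases Nat.lt_succ_iff_lt_or_eq.1 hc with hc | rfl
      · exact (hall c hc).1
      · exact le_antisymm h1 (by rw [heq]; exact h3)
    have hne : ∀ i, i ≤ q + 1 → minorSeq s a i ≠ 0 := by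
      intro i hi
      rcases i with _ | i
      · simp [minorSeq_zero]
      · rw [← abs_pos, hcol i (by omega), (hall i (by omega)).2]
        refine mul_pos hp ?_
        rcases i with _ | i
        · simp [hw1, wordState]
        · exact wordState_pos hp hw1 i _
    ext ⟨i, hi⟩ ⟨j, hj⟩
    simp only [Matrix.of_apply]
    rcases lt_trichotomy i (j + 1) with h | h | h
    · exact entry_eq_of_abs_minorSeq_eq hs hw (fun i hi => ha' i j hi (by omega))
        (fun i hi => hne i (by omega)) (hcol j hj) i (by omega)
    · subst h
      rw [hsub j hi, wordEntry, if_pos rfl]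
    · rw [hlow i j hi h, wordEntry, if_neg (by omega), if_neg (by omega)]

/-! ### Fibonacci polynomials and the greatest word values -/

/-- The Fibonacci polynomials, evaluated at `p`. -/
def fibPoly (p : ℝ) : ℕ → ℝ
  | 0 => 0
  | 1 => 1
  | k + 2 => p * fibPoly p (k + 1) + fibPoly p k

lemma fibPoly_add_two (p : ℝ) (k : ℕ) :
    fibPoly p (k + 2) = p * fibPoly p (k + 1) + fibPoly p k := rfl

lemma fibPoly_nonneg {p : ℝ} (hp : 0 ≤ p) : ∀ k, 0 ≤ fibPoly p k
  | 0 => le_rfl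
  | 1 => zero_le_one
  | k + 2 => by
    have h1 := fibPoly_nonneg hp (k + 1)
    have h2 := fibPoly_nonneg hp k
    rw [fibPoly_add_two]
    positivity

lemma fibPoly_pos {p : ℝ} (hp : 0 < p) : ∀ k, 0 < fibPoly p (k + 1)
  | 0 => zero_lt_one
  | k + 1 => by
    have h1 := fibPoly_pos hp k
    have h2 := fibPoly_nonneg hp.le k
    rw [fibPoly_add_two]
    positivity

lemma fibPoly_le_succ {p : ℝ} (hp : 1 ≤ p) (k : ℕ) : fibPoly p k ≤ fibPoly p (k + 1) := by
  rcases k with _ | k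
  · exact zero_le_one
  · rw [fibPoly_add_two]
    nlinarith [fibPoly_nonneg (zero_le_one.trans hp) k,
      fibPoly_nonneg (zero_le_one.trans hp) (k + 1)]

lemma fibPoly_one_lt {k : ℕ} (hk : 2 ≤ k) : fibPoly 1 k < fibPoly 1 (k + 1) := by
  obtain ⟨k, rfl⟩ : ∃ q, k = q + 2 := ⟨k - 2, by omega⟩
  rw [fibPoly_add_two 1 (k + 1)]
  linarith [fibPoly_pos one_pos k]

@[fun_prop]
lemma continuous_fibPoly : ∀ k, Continuous fun p => fibPoly p k
  | 0 => continuous_const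
  | 1 => continuous_const
  | k + 2 => (continuous_id.mul (continuous_fibPoly (k + 1))).add (continuous_fibPoly k)

lemma continuous_wordState (w : ℕ → Bool) (j : ℕ) :
    ∀ b, Continuous fun p => wordState p w j b := by
  induction j with
  | zero => exact fun b => continuous_const
  | succ j ih =>
    intro b
    simp only [wordState_succ]
    refine (ih b).add ?_
    split_ifs
    · exact continuous_id.mul (ih _)
    · exact continuous_const

lemma wordState_congr (p : ℝ) {w v : ℕ → Bool} (j : ℕ) (h : ∀ i, i ≤ j → w i = v i) :
    wordState p w j = wordState p v j := by
  induction j with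
  | zero => rfl
  | succ j ih =>
    funext b
    rw [wordState_succ, wordState_succ, ih fun i hi => h i (by omega), h _ le_rfl]

lemma wordState_self (p : ℝ) (w : ℕ → Bool) (j : ℕ) :
    wordState p w (j + 1) (w (j + 1)) =
      wordState p w j (w (j + 1)) + p * wordState p w j (!w (j + 1)) := by
  rw [wordState_succ, if_pos rfl]

lemma wordState_not (p : ℝ) (w : ℕ → Bool) (j : ℕ) :
    wordState p w (j + 1) (!w (j + 1)) = wordState p w j (!w (j + 1)) := by
  rw [wordState_succ, if_neg (by simp), add_zero]

/-- For `p ≥ 1` the Fibonacci polynomials bound both sums. -/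
lemma wordState_le_fibPoly {p : ℝ} (hp : 1 ≤ p) (w : ℕ → Bool) (j : ℕ) :
    ∃ b, wordState p w j b ≤ fibPoly p (j + 1) ∧ wordState p w j (!b) ≤ fibPoly p j := by
  have hp0 : 0 ≤ p := zero_le_one.trans hp
  induction j with
  | zero => exact ⟨true, by simp [wordState, fibPoly]⟩
  | succ j ih =>
    obtain ⟨b, h1, h2⟩ := ih
    have h3 := fibPoly_le_succ hp j
    refine ⟨w (j + 1), ?_, ?_⟩
    · rw [wordState_self, fibPoly_add_two]
      by_cases hb : b = w (j + 1)
      -- Feeding the larger sum again loses `(p - 1) * (fibPoly p (j + 1) - fibPoly p j) ≥ 0`; this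
      -- is where `p ≥ 1` enters.
      · rw [← hb]
        nlinarith
      · have hb' : w (j + 1) = !b := by cases b <;> cases h : w (j + 1) <;> simp_all
        rw [hb', Bool.not_not]
        nlinarith
    · rw [wordState_not]
      by_cases hb : b = w (j + 1)
      · rw [← hb]; exact h2.trans h3
      · have hb' : w (j + 1) = !b := by cases b <;> cases h : w (j + 1) <;> simp_all
        rw [hb', Bool.not_not]; exact h1

lemma wordState_le_fibPoly_succ {p : ℝ} (hp : 1 ≤ p) (w : ℕ → Bool) (j : ℕ) (c : Bool) :
    wordState p w j c ≤ fibPoly p (j + 1) := by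
  obtain ⟨b, h1, h2⟩ := wordState_le_fibPoly hp w j
  by_cases hb : c = b
  · rw [hb]; exact h1
  · rw [show c = !b by cases b <;> cases c <;> simp_all]
    exact h2.trans (fibPoly_le_succ hp j)

lemma wordState_add_le {w : ℕ → Bool} (j : ℕ) (b : Bool) :
    wordState 1 w j b + wordState 1 w j (!b) ≤ fibPoly 1 (j + 2) := by
  obtain ⟨c, h1, h2⟩ := wordState_le_fibPoly le_rfl w j
  rw [fibPoly_add_two]
  by_cases hb : b = c
  · rw [hb]; linarith
  · rw [show b = !c by cases b <;> cases c <;> simp_all, Bool.not_not]; linarith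

/-- At `p = 1`, the words whose sums are consecutive Fibonacci numbers. -/
lemma word_of_wordState_add_eq {w : ℕ → Bool} (j : ℕ)
    (h : wordState 1 w (j + 1) (w (j + 1)) + wordState 1 w (j + 1) (!w (j + 1)) =
      fibPoly 1 (j + 3)) :
    w 1 = false ∧ (∀ i, 2 ≤ i → i ≤ j → w (i + 1) = !w i) ∧
      wordState 1 w (j + 1) (w (j + 1)) = fibPoly 1 (j + 2) ∧
      wordState 1 w (j + 1) (!w (j + 1)) = fibPoly 1 (j + 1) := by
  induction j with
  | zero =>
    have h1 : w 1 = false := by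
      by_contra hc
      simp only [Bool.not_eq_false] at hc
      simp [hc, wordState, fibPoly] at h
    refine ⟨h1, fun i hi hi' => by omega, ?_, ?_⟩ <;> simp [h1, wordState, fibPoly]
  | succ j ih =>
    have hle := wordState_add_le (w := w) (j + 1) (w (j + 1 + 1))
    have hle' := wordState_le_fibPoly_succ le_rfl w (j + 1) (!w (j + 1 + 1))
    have hf : fibPoly 1 (j + 1 + 3) = fibPoly 1 (j + 3) + fibPoly 1 (j + 2) := by
      rw [fibPoly_add_two 1 (j + 2)]; ring
    rw [wordState_self, wordState_not, hf] at h
    -- The new total is the old total plus one old sum. Each has its own Fibonacci bound, so both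
    -- bounds are attained.
    have e1 : wordState 1 w (j + 1) (w (j + 1 + 1)) + wordState 1 w (j + 1) (!w (j + 1 + 1)) =
      fibPoly 1 (j + 3) := by linarith
    have e2 : wordState 1 w (j + 1) (!w (j + 1 + 1)) = fibPoly 1 (j + 2) := by linarith
    have e3 : wordState 1 w (j + 1) (w (j + 1)) + wordState 1 w (j + 1) (!w (j + 1)) =
        fibPoly 1 (j + 3) := by
      by_cases hb : w (j + 1 + 1) = w (j + 1)
      · rw [← hb]; exact e1
      · rw [show w (j + 1 + 1) = !w (j + 1) by
          cases h1 : w (j + 1) <;> cases h2 : w (j + 1 + 1) <;> simp_all, Bool.not_not] at e1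
        linarith
    obtain ⟨h1, h2, h3, h4⟩ := ih e3
    refine ⟨h1, ?_, ?_, ?_⟩
    · intro i hi hij
      rcases Nat.le_succ_iff.1 hij with hij | rfl
      · exact h2 i hi hij
      · by_contra hc
        have hb : w (j + 1 + 1) = w (j + 1) := by
          cases h1 : w (j + 1) <;> cases h2 : w (j + 1 + 1) <;> simp_all
        rw [hb, h4] at e2
        -- A repeated letter would equate consecutive Fibonacci numbers. Only `F₁ = F₂` allows this,
        -- which is why alternation is forced from index 2 on.
        exact (fibPoly_one_lt hi).ne e2
    · rw [wordState_self, one_mul, e1]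
    · rw [wordState_not, e2]

/-- The sums along an alternating word. -/
lemma wordState_of_alternating (p : ℝ) {w : ℕ → Bool} {i : ℕ} {x y : ℝ}
    (hx : wordState p w (i + 1) (w (i + 1)) = p * x + y)
    (hy : wordState p w (i + 1) (!w (i + 1)) = x) (f : ℕ → ℝ) (f0 : f 0 = x)
    (f1 : f 1 = p * x + y) (hf : ∀ k, f (k + 2) = p * f (k + 1) + f k) (k : ℕ)
    (h : ∀ l, i + 1 ≤ l → l < i + 1 + k → w (l + 1) = !w l) :
    wordState p w (i + 1 + k) (w (i + 1 + k)) = f (k + 1) ∧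
      wordState p w (i + 1 + k) (!w (i + 1 + k)) = f k := by
  induction k with
  | zero => exact ⟨by rw [f1]; exact hx, by rw [f0]; exact hy⟩
  | succ k ih =>
    obtain ⟨h1, h2⟩ := ih fun l hl hl' => h l hl (by omega)
    have hw : w (i + 1 + (k + 1)) = !w (i + 1 + k) := h (i + 1 + k) (by omega) (by omega)
    rw [← add_assoc] at hw ⊢
    rw [wordState_self, wordState_not, hw, Bool.not_not, h1, h2, hf]
    exact ⟨by ring, rfl⟩

lemma wordState_alternating (p : ℝ) {w : ℕ → Bool} (hw1 : w 1 = false) (k : ℕ)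
    (h : ∀ l, 1 ≤ l → l < 1 + k → w (l + 1) = !w l) :
    wordState p w (1 + k) (w (1 + k)) = fibPoly p (k + 2) ∧
      wordState p w (1 + k) (!w (1 + k)) = fibPoly p (k + 1) := by
  have := wordState_of_alternating p (w := w) (i := 0) (x := 1) (y := 0)
    (by simp [hw1, wordState]) (by simp [hw1, wordState]) (fun k => fibPoly p (k + 1)) rfl
    (by simp [fibPoly]) (fun k => fibPoly_add_two p _) k (by simpa using h)
  simpa using this

/-- Delaying the first sign change gives the sums `2 * p` and `1` at index 2; alternation then
propagates them by the Fibonacci recurrence. -/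
lemma wordState_double_alternating (p : ℝ) {w : ℕ → Bool} (hw1 : w 1 = false)
    (hw2 : w 2 = false) (k : ℕ) (h : ∀ l, 2 ≤ l → l < 2 + k → w (l + 1) = !w l) :
    wordState p w (2 + k) (w (2 + k)) = fibPoly p (k + 2) + p * fibPoly p (k + 1) ∧
      wordState p w (2 + k) (!w (2 + k)) = fibPoly p (k + 1) + p * fibPoly p k := by
  have := wordState_of_alternating p (w := w) (i := 1) (x := 1) (y := p)
    (by simp [hw1, hw2, wordState]) (by simp [hw1, hw2, wordState])
    (fun k => fibPoly p (k + 1) + p * fibPoly p k)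
    (by simp [fibPoly]) (by simp [fibPoly])
    (fun k => by simp only [fibPoly_add_two]; ring) k (by simpa using h)
  simpa using this

lemma decide_odd_eq_not (k : ℕ) : decide (Odd k) = !decide (Even k) := by
  simp [← Nat.not_even_iff_odd]

/-! ### The two competing words near `p = 1` -/

/-- Sign word of `U`. -/
def altWord (k : ℕ) : Bool := decide (Even k)

/-- Sign word of `U^{(rc)}`: alternating, with the first and the last change of sign delayed. -/
def rcWord (n k : ℕ) : Bool := if 2 ≤ k ∧ k + 2 ≤ n then decide (Odd k) else decide (Even k)

lemma altWord_succ (k : ℕ) : altWord (k + 1) = !altWord k := by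
  simp [altWord, Nat.even_add_one, decide_odd_eq_not]

/-- The value of the sign word of `U^{(rc)}` of order `k + 4`. -/
def rcValue (p : ℝ) (k : ℕ) : ℝ :=
  fibPoly p (k + 2) + 2 * p * fibPoly p (k + 1) + p ^ 2 * fibPoly p k

/-- The sign of `1 - p ^ 2` is the source of the switch at `s = t`. -/
lemma rcValue_sub (p : ℝ) (k : ℕ) :
    rcValue p k - fibPoly p (k + 4) = p * (1 - p ^ 2) * fibPoly p (k + 1) := by
  simp only [rcValue, fibPoly_add_two]
  ring

lemma rcValue_add_two (p : ℝ) (k : ℕ) :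
    rcValue p (k + 2) = p * rcValue p (k + 1) + rcValue p k := by
  simp only [rcValue, fibPoly_add_two]
  ring

lemma wordState_altWord (p : ℝ) (k : ℕ) :
    wordState p altWord (k + 1) (!altWord (k + 2)) = fibPoly p (k + 2) := by
  rw [altWord_succ, Bool.not_not, add_comm]
  exact (wordState_alternating p (by decide) k fun l _ _ => altWord_succ l).1

lemma wordState_of_rc (p : ℝ) {w : ℕ → Bool} (k : ℕ) (hw1 : w 1 = false)
    (hw2 : w 2 = false) (h : ∀ l, 2 ≤ l → l < 2 + k → w (l + 1) = !w l)
    (h3 : w (k + 3) = w (k + 2)) (h4 : w (k + 4) = !w (k + 3)) :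
    wordState p w (k + 3) (!w (k + 4)) = rcValue p k := by
  obtain ⟨h5, h6⟩ := wordState_double_alternating p hw1 hw2 k h
  rw [add_comm 2 k] at h5 h6
  rw [h4, Bool.not_not, wordState_self, h3, h5, h6, rcValue]
  ring

lemma wordState_rcWord (p : ℝ) (k : ℕ) :
    wordState p (rcWord (k + 4)) (k + 3) (!rcWord (k + 4) (k + 4)) = rcValue p k := by
  refine wordState_of_rc p k ?_ ?_ ?_ ?_ ?_
  · simp [rcWord]
  · simp [rcWord]
  · intro l hl hl'
    simp only [rcWord]
    rw [if_pos (by omega), if_pos (by omega)]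
    simp [Nat.odd_add_one, decide_odd_eq_not]
  · simp only [rcWord]
    rw [if_neg (by omega), if_pos (by omega)]
    simp [parity_simps, decide_odd_eq_not]
  · simp only [rcWord]
    rw [if_neg (by omega), if_neg (by omega)]
    simp [parity_simps, decide_odd_eq_not]

/-- A word of greatest value at `p = 1` other than `rcWord` loses to it for `p < 1` near `1`. -/
lemma wordState_lt_of_eq {k : ℕ} {w : ℕ → Bool} (hw0 : w 0 = true)
    (h : wordState 1 w (k + 3) (!w (k + 4)) = fibPoly 1 (k + 4))
    (hne : ∃ i, i ≤ k + 4 ∧ w i ≠ rcWord (k + 4) i) {p : ℝ} (hp0 : 0 < p) (hp1 : p < 1)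
    (hlt : fibPoly p (k + 1) + p * fibPoly p k < fibPoly p (k + 2) + p * fibPoly p (k + 1)) :
    wordState p w (k + 3) (!w (k + 4)) < rcValue p k := by
  -- Otherwise letter `k + 3` is wasted and the value is at most the previous Fibonacci number.
  have h4 : w (k + 4) = !w (k + 3) := by
    by_contra hc
    have hc' : w (k + 3 + 1) = w (k + 3) := by
      cases h1 : w (k + 4) <;> cases h2 : w (k + 3) <;> simp_all
    rw [hc', wordState_not] at h
    have := wordState_le_fibPoly_succ le_rfl w (k + 2) (!w (k + 3))
    have := fibPoly_one_lt (show 2 ≤ k + 3 by omega)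
    linarith
  rw [h4, Bool.not_not, wordState_self, one_mul] at h
  -- At `p = 1` the last step adds the two sums whichever way `w (k + 3)` points, so that letter is
  -- free.
  have hsum : wordState 1 w (k + 2) (w (k + 2)) + wordState 1 w (k + 2) (!w (k + 2)) =
      fibPoly 1 (k + 4) := by
    by_cases hb : w (k + 2 + 1) = w (k + 2)
    · rw [← hb]; exact h
    · rw [show w (k + 2 + 1) = !w (k + 2) by
        cases h1 : w (k + 2) <;> cases h2 : w (k + 2 + 1) <;> simp_all, Bool.not_not] at h
      linarith
  obtain ⟨hw1, halt, -, -⟩ := word_of_wordState_add_eq (k + 1) hsum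
  rw [h4, Bool.not_not, wordState_self]
  have hU := rcValue_sub p k
  have hpos : 0 < p * (1 - p ^ 2) * fibPoly p (k + 1) := by
    have := fibPoly_pos hp0 k
    have : 0 < 1 - p ^ 2 := by nlinarith
    positivity
  have hRdef : rcValue p k =
    fibPoly p (k + 2) + 2 * p * fibPoly p (k + 1) + p ^ 2 * fibPoly p k := rfl
  have hf3 := fibPoly_add_two p (k + 1)
  have hf2 := fibPoly_add_two p k
  have hf4 := fibPoly_add_two p (k + 2)
  have hflip : w (k + 3) ≠ w (k + 2) → w (k + 3) = !w (k + 2) := fun hb => by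
    cases h1 : w (k + 2) <;> cases h2 : w (k + 3) <;> simp_all
  cases hw2 : w 2
  · obtain ⟨h5, h6⟩ := wordState_double_alternating p hw1 hw2 k
      fun l hl hl' => halt l hl (by omega)
    rw [add_comm 2 k] at h5 h6
    by_cases h3 : w (k + 3) = w (k + 2)
    · exfalso
      obtain ⟨i, hi, hwi⟩ := hne
      have main : ∀ l, l ≤ k → w (l + 2) = decide (Odd l) := by
        intro l
        induction l with
        | zero => intro _; simp [hw2]
        | succ l ih =>
          intro hl
          rw [show l + 1 + 2 = l + 2 + 1 by ring, halt (l + 2) (by omega) (by omega),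
            ih (by omega)]
          simp [Nat.odd_add_one, decide_odd_eq_not]
      apply hwi
      rw [rcWord]
      by_cases hc : 2 ≤ i ∧ i + 2 ≤ k + 4
      · rw [if_pos hc]
        obtain ⟨l, rfl⟩ : ∃ l, i = l + 2 := ⟨i - 2, by omega⟩
        rw [main l (by omega)]
        simp [parity_simps, decide_odd_eq_not]
      · rw [if_neg hc]
        have : i = 0 ∨ i = 1 ∨ i = k + 3 ∨ i = k + 4 := by omega
        rcases this with rfl | rfl | rfl | rfl
        · simpa using hw0
        · simpa using hw1
        · rw [h3, main k le_rfl]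
          simp [parity_simps, decide_odd_eq_not]
        · rw [h4, h3, main k le_rfl]
          simp [parity_simps, decide_odd_eq_not]
    -- With `X > Y` the two sums of `hlt`, the value is `Y + p * X` against `X + p * Y`; the gap is
    -- `(1 - p) * (X - Y)`.
    · rw [hflip h3, Bool.not_not, h5, h6]
      nlinarith
  · obtain ⟨h5, h6⟩ := wordState_alternating p hw1 (k + 1) fun l hl hl' => by
      rcases Nat.lt_or_ge l 2 with h | h
      · obtain rfl : l = 1 := by omega
        rw [hw1, hw2]; rfl
      · exact halt l h (by omega)
    rw [show 1 + (k + 1) = k + 2 by ring] at h5 h6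
    by_cases h3 : w (k + 3) = w (k + 2)
    -- Delaying only the last change gives the same value `Y + p * X` as delaying only the first.
    · rw [h3, h5, h6]
      simp only [show k + 1 + 2 = k + 3 by ring, show k + 1 + 1 = k + 2 by ring] at *
      nlinarith
    · rw [hflip h3, Bool.not_not, h5, h6]
      simp only [show k + 1 + 2 = k + 3 by ring, show k + 1 + 1 = k + 2 by ring,
        show k + 2 + 2 = k + 4 by ring] at *
      linarith

/-- For `p < 1` near `1` the word `rcWord` has the strictly greatest value. -/
lemma eventually_wordState_lt (k : ℕ) :
    ∀ᶠ p : ℝ in 𝓝 1, p < 1 → ∀ w : ℕ → Bool, w 0 = true →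
      (∃ i, i ≤ k + 4 ∧ w i ≠ rcWord (k + 4) i) →
      wordState p w (k + 3) (!w (k + 4)) < rcValue p k := by
  have hcont : Continuous fun p => rcValue p k := by unfold rcValue; fun_prop
  have hone : rcValue 1 k = fibPoly 1 (k + 4) := by linarith [rcValue_sub 1 k]
  have hpos : ∀ᶠ p : ℝ in 𝓝 1, 0 < p := eventually_gt_nhds one_pos
  have hlt : ∀ᶠ p : ℝ in 𝓝 1,
      fibPoly p (k + 1) + p * fibPoly p k < fibPoly p (k + 2) + p * fibPoly p (k + 1) := by
    refine ContinuousAt.eventually_lt (Continuous.continuousAt (by fun_prop))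
      (Continuous.continuousAt (by fun_prop)) ?_
    have h1 := fibPoly_add_two 1 k
    have h2 := fibPoly_pos one_pos k
    rcases k with _ | k
    · simp [fibPoly]
    · have := fibPoly_le_succ le_rfl k
      have := fibPoly_pos one_pos k
      have := fibPoly_add_two 1 k
      simp only [one_mul] at *
      linarith
  -- Only letters `0` to `k + 4` matter, so finitely many truncated words suffice and their
  -- neighbourhoods can be intersected.
  have hfin : ∀ᶠ p : ℝ in 𝓝 1, ∀ v : Fin (k + 5) → Bool,
      wordState 1 (fun i => if h : i < k + 5 then v ⟨i, h⟩ else true) (k + 3)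
        (!v (Fin.last _)) < fibPoly 1 (k + 4) →
      wordState p (fun i => if h : i < k + 5 then v ⟨i, h⟩ else true) (k + 3)
        (!v (Fin.last _)) < rcValue p k := by
    rw [eventually_all]
    intro v
    by_cases hv : wordState 1 (fun i => if h : i < k + 5 then v ⟨i, h⟩ else true) (k + 3)
        (!v (Fin.last _)) < fibPoly 1 (k + 4)
    · filter_upwards [ContinuousAt.eventually_lt (continuous_wordState _ _ _).continuousAt
        hcont.continuousAt (hone.symm ▸ hv)] with p hp _
      exact hp
    · exact Eventually.of_forall fun p h => absurd h hv
  filter_upwards [hpos, hlt, hfin] with p hp0 hlt hfin hp1 w hw0 hne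
  rcases (wordState_le_fibPoly_succ le_rfl w (k + 3) (!w (k + 4))).lt_or_eq with h | h
  · have hc : ∀ q, wordState q (fun i => if h : i < k + 5 then w i else true) (k + 3) =
        wordState q w (k + 3) := fun q =>
      wordState_congr q _ fun i hi => dif_pos (by omega)
    have := hfin (fun i => w i)
    simp only [Fin.val_last] at this
    rw [hc, hc] at this
    exact this h
  · exact wordState_lt_of_eq hw0 h hne hp0 hp1 hlt

lemma wordState_le_of_one_le {p : ℝ} (hp : 1 ≤ p) (w : ℕ → Bool) (k : ℕ) (c : Bool) :
    wordState p w (k + 3) c ≤ fibPoly p (k + 4) := wordState_le_fibPoly_succ hp w _ c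

/-! ### Identification of the matrices and comparison of determinants -/

lemma matU_eq (n : ℕ) (s t : ℝ) :
    matU n s t = Matrix.of fun i j : Fin n => wordEntry s t altWord i j := by
  ext i j
  simp only [matU, uEntry, wordEntry, Matrix.of_apply]
  refine if_congr Iff.rfl rfl (if_congr (and_congr_right fun h => ?_) rfl rfl)
  rw [Nat.even_sub h, altWord_succ, altWord, altWord]
  by_cases h1 : Even (i : ℕ) <;> by_cases h2 : Even (j : ℕ) <;> simp [h1, h2]

set_option maxHeartbeats 1000000 in
lemma matUrc_eq (k : ℕ) (s t : ℝ) :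
    matUrc (k + 4) s t =
      Matrix.of fun i j : Fin (k + 4) => wordEntry s t (rcWord (k + 4)) i j := by
  ext ⟨i, hi⟩ ⟨j, hj⟩
  -- Shifting `b` by one inside the middle block makes the word the parity of `r`, so every case
  -- becomes linear arithmetic.
  have hw : ∀ b : ℕ, ∃ r, (2 ≤ b ∧ b + 2 ≤ k + 4 ∧ r = b + 1 ∨ (b < 2 ∨ k + 4 < b + 2) ∧ r = b) ∧
      rcWord (k + 4) b = decide (r % 2 = 0) := by
    intro b
    by_cases hb : 2 ≤ b ∧ b + 2 ≤ k + 4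
    · refine ⟨b + 1, by omega, ?_⟩
      rw [rcWord, if_pos hb, decide_eq_decide, Nat.odd_iff]
      omega
    · exact ⟨b, by omega, by rw [rcWord, if_neg hb, decide_eq_decide, Nat.even_iff]⟩
  have hrow : ∃ i', Equiv.swap 0 1 i = i' ∧ (i = 0 ∧ i' = 1 ∨ i = 1 ∧ i' = 0 ∨ 2 ≤ i ∧ i' = i) :=
    ⟨_, rfl, by rw [Equiv.swap_apply_def]; split_ifs <;> omega⟩
  have hcol : ∃ j', Equiv.swap (k + 4 - 2) (k + 4 - 1) j = j' ∧
      (j = k + 2 ∧ j' = k + 3 ∨ j = k + 3 ∧ j' = k + 2 ∨ j < k + 2 ∧ j' = j) :=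
    ⟨_, rfl, by rw [Equiv.swap_apply_def]; split_ifs <;> omega⟩
  obtain ⟨i', hi', hrow⟩ := hrow
  obtain ⟨j', hj', hcol⟩ := hcol
  obtain ⟨r, hr, hr'⟩ := hw i
  obtain ⟨q, hq, hq'⟩ := hw (j + 1)
  simp only [matUrc, Matrix.of_apply, urcSwappedEntry, uEntry, wordEntry, hi', hj', hr', hq',
    ne_eq, decide_eq_decide, Nat.even_iff]
  clear hi' hj' hr' hq' hw
  rcases hr with ⟨hr1, hr2, rfl⟩ | ⟨hr, rfl⟩ <;> rcases hq with ⟨hq1, hq2, rfl⟩ | ⟨hq, rfl⟩ <;>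
  rcases hrow with ⟨rfl, rfl⟩ | ⟨rfl, rfl⟩ | ⟨hi1, rfl⟩ <;>
  rcases hcol with ⟨rfl, rfl⟩ | ⟨rfl, rfl⟩ | ⟨hj1, rfl⟩ <;>
  first
  | (exfalso; omega)
  | (split_ifs <;> first
      | rfl
      | (exfalso; omega)
      | (exfalso
         simp only [false_and, and_false, false_or, false_iff, Nat.zero_mod, true_iff,
          true_and] at *; omega))

lemma matU_mem (n : ℕ) {s t : ℝ} (ht : 0 ≤ t) : matU n s t ∈ hessenberg n s (Set.Icc 0 t) :=
  matU_eq n s t ▸ wordEntry_mem ht _ n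

lemma matUrc_mem (k : ℕ) {s t : ℝ} (ht : 0 ≤ t) :
    matUrc (k + 4) s t ∈ hessenberg (k + 4) s (Set.Icc 0 t) :=
  matUrc_eq k s t ▸ wordEntry_mem ht _ _

lemma abs_det_matU (k : ℕ) {s t : ℝ} (hs : 0 < s) (ht : 0 < t) :
    |(matU (k + 4) s t).det| = s ^ (k + 3) * t * fibPoly (t / s) (k + 4) := by
  rw [matU_eq, abs_det_wordEntry hs ht (m := k + 3) (by decide), wordState_altWord]

lemma abs_det_matUrc (k : ℕ) {s t : ℝ} (hs : 0 < s) (ht : 0 < t) :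
    |(matUrc (k + 4) s t).det| = s ^ (k + 3) * t * rcValue (t / s) k := by
  rw [matUrc_eq, abs_det_wordEntry hs ht (m := k + 3) (by simp [rcWord]), wordState_rcWord]

lemma abs_det_matUrc_sub (k : ℕ) {s t : ℝ} (hs : 0 < s) (ht : 0 < t) :
    |(matUrc (k + 4) s t).det| - |(matU (k + 4) s t).det| =
      s ^ (k + 3) * t * (t / s * fibPoly (t / s) (k + 1)) * (1 - (t / s) ^ 2) := by
  rw [abs_det_matU k hs ht, abs_det_matUrc k hs ht, ← mul_sub, rcValue_sub]
  ring

lemma abs_det_le_of_le (k : ℕ) {s t : ℝ} (hs : 0 < s) (ht : 0 < t) (hst : s ≤ t)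
    {A : Matrix (Fin (k + 4)) (Fin (k + 4)) ℝ} (hA : A ∈ hessenberg (k + 4) s (Set.Icc 0 t)) :
    |A.det| ≤ |(matU (k + 4) s t).det| := by
  obtain ⟨w, -, hle, -⟩ := exists_word_bound (m := k + 3) hs ht hA
  rw [abs_det_matU k hs ht]
  exact hle.trans (mul_le_mul_of_nonneg_left
    (wordState_le_of_one_le ((one_le_div hs).2 hst) w k _) (by positivity))

lemma isMaximizing_matU_iff (k : ℕ) {s t : ℝ} (hs : 0 < s) (ht : 0 < t) :
    IsMaximizing (k + 4) s t (matU (k + 4) s t) ↔ s ≤ t := by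
  refine ⟨fun h => ?_, fun h => ⟨matU_mem _ ht.le, fun B hB => abs_det_le_of_le k hs ht h hB⟩⟩
  by_contra! hc
  have h1 := h.2 _ (matUrc_mem k ht.le)
  have h2 := abs_det_matUrc_sub k hs ht
  have h3 := fibPoly_pos (div_pos ht hs) k
  have h4 : (t / s) ^ 2 < 1 := pow_lt_one₀ (by positivity) ((div_lt_one hs).2 hc) two_ne_zero
  have : 0 < s ^ (k + 3) * t * (t / s * fibPoly (t / s) (k + 1)) * (1 - (t / s) ^ 2) :=
    mul_pos (by positivity) (by linarith)
  linarith

lemma not_isMaximizing_matUrc (k : ℕ) {s t : ℝ} (hs : 0 < s) (hst : s < t) :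
    ¬ IsMaximizing (k + 4) s t (matUrc (k + 4) s t) := by
  intro h
  have ht : 0 < t := hs.trans hst
  have h1 := h.2 _ (matU_mem _ ht.le)
  have h2 := abs_det_matUrc_sub k hs ht
  have h3 := fibPoly_pos (div_pos ht hs) k
  have h4 : 1 < (t / s) ^ 2 := one_lt_pow₀ ((one_lt_div hs).2 hst) two_ne_zero
  have : s ^ (k + 3) * t * (t / s * fibPoly (t / s) (k + 1)) * (1 - (t / s) ^ 2) < 0 :=
    mul_neg_of_pos_of_neg (by positivity) (by linarith)
  linarith

/-- `U^{(rc)}` is maximizing, and uniquely so off the diagonal, when its sign word has the strictly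
greatest value. -/
lemma isMaximizing_matUrc_of_word (k : ℕ) {s t : ℝ} (ht : 0 < t) (hst : t ≤ s)
    (h : t / s < 1 → ∀ w : ℕ → Bool, w 0 = true → (∃ i, i ≤ k + 4 ∧ w i ≠ rcWord (k + 4) i) →
      wordState (t / s) w (k + 3) (!w (k + 4)) < rcValue (t / s) k) :
    IsMaximizing (k + 4) s t (matUrc (k + 4) s t) ∧
      (t < s → ∀ A, IsMaximizing (k + 4) s t A → A = matUrc (k + 4) s t) := by
  have hs : 0 < s := ht.trans_le hst
  -- At `s = t` both determinants agree in absolute value, so maximality passes from `U` to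
  -- `U^{(rc)}`.
  rcases hst.eq_or_lt with rfl | hlt
  · refine ⟨⟨matUrc_mem k ht.le, fun B hB => ?_⟩, fun h => absurd h (lt_irrefl _)⟩
    have h2 := abs_det_matUrc_sub k hs ht
    rw [div_self ht.ne', one_pow, sub_self, mul_zero] at h2
    linarith [abs_det_le_of_le k hs ht le_rfl hB]
  have h := h ((div_lt_one hs).2 hlt)
  have hag : ∀ w : ℕ → Bool, (∀ i, i ≤ k + 4 → w i = rcWord (k + 4) i) →
      wordState (t / s) w (k + 3) (!w (k + 4)) = rcValue (t / s) k := fun w hw => by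
    rw [wordState_congr _ (k + 3) fun i hi => hw i (by omega), hw _ le_rfl, wordState_rcWord]
  refine ⟨⟨matUrc_mem k ht.le, fun B hB => ?_⟩, fun _ A hA => ?_⟩
  · obtain ⟨w, hw0, hle, -⟩ := exists_word_bound (m := k + 3) hs ht hB
    rw [abs_det_matUrc k hs ht]
    refine hle.trans (mul_le_mul_of_nonneg_left ?_ (by positivity))
    by_cases hw : ∀ i, i ≤ k + 4 → w i = rcWord (k + 4) i
    · exact (hag w hw).le
    · push Not at hw
      exact (h w hw0 hw).le
  · obtain ⟨w, hw0, hle, huniq⟩ := exists_word_bound (m := k + 3) hs ht hA.1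
    have hge := hA.2 _ (matUrc_mem k ht.le)
    rw [abs_det_matUrc k hs ht] at hge
    by_cases hw : ∀ i, i ≤ k + 4 → w i = rcWord (k + 4) i
    · have hval := hag w hw
      rw [huniq (by omega) (by rw [hw 1 (by omega)]; simp [rcWord]) ?_ ?_, matUrc_eq]
      · ext i j
        simp only [Matrix.of_apply, wordEntry]
        rw [hw i (by omega), hw (j + 1) (by omega)]
      · rw [hw _ le_rfl, hw (k + 3) (by omega)]
        simp only [rcWord]
        rw [if_neg (by omega), if_neg (by omega)]
        simp [parity_simps, decide_odd_eq_not]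
      · exact le_antisymm hle (by rw [hval]; exact hge)
    · push Not at hw
      have := mul_lt_mul_of_pos_left (h w hw0 hw) (show 0 < s ^ (k + 3) * t by positivity)
      exact absurd (hge.trans hle) (not_le.2 this)

/-! ### The uniform `ε` and the recurrence for the maximum -/

lemma IsMaximizing.maxAbsDet_eq {n : ℕ} {s t : ℝ} {A : Matrix (Fin n) (Fin n) ℝ}
    (h : IsMaximizing n s t A) : maxAbsDet n s t = |A.det| :=
  IsGreatest.csSup_eq ⟨⟨A, h.1, rfl⟩, by rintro _ ⟨B, hB, rfl⟩; exact h.2 B hB⟩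

/-- A uniform neighbourhood of `s = t` on which `U^{(rc)}` is maximizing up to order `n`. -/
lemma exists_pos_isMaximizing_matUrc (n : ℕ) :
    ∃ ε : ℝ, 0 < ε ∧ ∀ s t : ℝ, 0 < t → t ≤ s → s ≤ t * (1 + ε) → ∀ k, k ≤ n →
      IsMaximizing (k + 4) s t (matUrc (k + 4) s t) ∧
        (t < s → ∀ A, IsMaximizing (k + 4) s t A → A = matUrc (k + 4) s t) := by
  have hev := (Finset.eventually_all (Finset.range (n + 1))).2 fun k _ => eventually_wordState_lt k
  obtain ⟨δ, hδ, hball⟩ := Metric.eventually_nhds_iff.1 hev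
  -- `1 - t / s ≤ (δ / 2) * (t / s) ≤ δ / 2`, and halving gives the strict inequality. All orders
  -- share one `δ`, as the recurrence for the maxima requires.
  refine ⟨δ / 2, by positivity, fun s t ht hst hs k hk => ?_⟩
  refine isMaximizing_matUrc_of_word k ht hst (hball ?_ k (by simpa [Nat.lt_succ_iff] using hk))
  have hs0 : 0 < s := ht.trans_le hst
  rw [Real.dist_eq, abs_sub_comm, abs_of_nonneg (sub_nonneg.2 ((div_le_one hs0).2 hst)),
    sub_lt_comm, lt_div_iff₀ hs0]
  nlinarith [mul_pos hδ hs0]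

theorem theorem2p8 (n : ℕ) (hn : 4 ≤ n) :
    -- the regime `t ≤ s ≤ t (1 + ε(n))`
    (∃ ε : ℝ, 0 < ε ∧ ∀ s t : ℝ, 0 < t → t ≤ s → s ≤ t * (1 + ε) →
      maxAbsDet 4 s t = 3 * s ^ 2 * t ^ 2 ∧
      (5 ≤ n → maxAbsDet 5 s t = s ^ 4 * t + 4 * s ^ 2 * t ^ 3) ∧
      (∀ m : ℕ, 5 < m → m ≤ n →
        maxAbsDet m s t = t * maxAbsDet (m - 1) s t + s ^ 2 * maxAbsDet (m - 2) s t) ∧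
      IsMaximizing n s t (matUrc n s t) ∧
      (t < s → ∀ A : Matrix (Fin n) (Fin n) ℝ, IsMaximizing n s t A → A = matUrc n s t)) ∧
    -- the switch at `s / t = 1`
    (∀ s t : ℝ, 0 < s → 0 < t → (IsMaximizing n s t (matU n s t) ↔ s ≤ t)) ∧
    (∀ s t : ℝ, 0 < s → s < t → ¬ IsMaximizing n s t (matUrc n s t)) := by
  obtain ⟨k, rfl⟩ : ∃ k, n = k + 4 := ⟨n - 4, by omega⟩
  refine ⟨?_, fun s t hs ht => isMaximizing_matU_iff k hs ht,
    fun s t hs hst => not_isMaximizing_matUrc k hs hst⟩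
  obtain ⟨ε, hε, h⟩ := exists_pos_isMaximizing_matUrc k
  refine ⟨ε, hε, fun s t ht hst hs => ?_⟩
  have h := h s t ht hst hs
  have hs0 : 0 < s := ht.trans_le hst
  have hM : ∀ l, l ≤ k → maxAbsDet (l + 4) s t = s ^ (l + 3) * t * rcValue (t / s) l :=
    fun l hl => by rw [(h l hl).1.maxAbsDet_eq, abs_det_matUrc l hs0 ht]
  refine ⟨?_, fun h5 => ?_, fun m hm hmk => ?_, h k le_rfl⟩
  · rw [hM 0 (by omega)]
    simp only [rcValue, fibPoly]
    field_simp
    ring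
  · rw [hM 1 (by omega)]
    simp only [rcValue, fibPoly]
    field_simp
    ring
  · obtain ⟨l, rfl⟩ : ∃ l, m = l + 2 + 4 := ⟨m - 6, by omega⟩
    rw [show l + 2 + 4 - 1 = l + 1 + 4 by omega, show l + 2 + 4 - 2 = l + 4 by omega,
      hM (l + 2) (by omega), hM (l + 1) (by omega), hM l (by omega), rcValue_add_two]
    field_simp
    ring
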